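/- For an integer $m\ge 1$ let $$L_m=\{\,x\,0^{2^{|x|/m}-|x|}\,\$\,0^{2^{|x|/m}-|x|}\,x^T \;:\; x\in\{0,1\}^*\,\}\subseteq\{0,1,\$\}^*,$$ where $x^T$ is the reversal of $x$ and $x$ ranges over those binary words for which the exponent $2^{|x|/m}-|x|$ is a nonnegative integer (that is, $m$ divides $|x|$ and $|x|\le 2^{|x|/m}$). A 4-counter machine is a finite-state machine (deterministic or nondeterministic) with a two-way read-only input head on a tape bordered by end-markers and with four unbounded integer counters. In one step, depending on the state, the scanned symbol and on which counters are zero, it changes state, moves the head by at most one cell and changes each counter by at most one. It starts on the cell to the right of the left end-marker with all counters zero, and accepts by reaching an accepting state. Let $M$ be a 4-counter machine that accepts exactly $L_m$. Then for all sufficiently large $n$ such that $L_m$ contains words of length $n$, there is a word $w\in L_m$ of length $n$ such that every accepting computation of $M$ on $w$ has at least $(m/13)\,n$ steps. Consequently, for no constant $c<m/13$ does $M$ accept all sufficiently long words $w\in L_m$ within $c\,|w|$ steps; in this sense acceptance of $L_m$ on 4-counter machines cannot be sped up below time $(m/13)\,n$. (For instance, $L_{39}$ cannot be accepted in time $2n$.)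 -/

import Mathlib

/-- The content of a cell of a read-only input tape that is bordered by two end-markers. -/
inductive TapeSymbol (α : Type*) where
  | leftEnd
  | rightEnd
  | letter (a : α)

/-- A two-way `k`-counter machine with input alphabet `α` and set of states `Q`, which is assumed
finite in all uses. Depending on the state, the scanned symbol and the outcomes of the
zero-tests of the `k` counters (`true` means zero), a step goes to a new state, moves the
input head by `-1`, `0` or `1` and adds `-1`, `0` or `1` to each counter. The machine is in general
nondeterministic; it is deterministic if `next` offers at most one option in every situation. -/
structure CounterMachine (k : ℕ) (α : Type*) (Q : Type*) where
  start : Q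
  accept : Set Q
  next : Q → TapeSymbol α → (Fin k → Bool) → Set (Q × SignType × (Fin k → SignType))

namespace CounterMachine

/-- The tape with input `w`: the left end-marker is at position `0`, the letters of `w` are at the
positions `1, …, |w|`, the right end-marker is at position `|w| + 1` (the head cannot go beyond). -/
def tape {α : Type*} (w : List α) : ℕ → TapeSymbol α
  | 0 => .leftEnd
  | i + 1 => match w[i]? with
    | some a => .letter a
    | none => .rightEnd

/-- A configuration: state, position of the input head, contents of the (unbounded) counters. -/
structure Config (k : ℕ) (Q : Type*) where
  state : Q
  pos : ℕ
  counter : Fin k → ℤ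

variable {k : ℕ} {α Q : Type*}

/-- Initially the head is right of the left end-marker and all counters are zero. -/
def initial (M : CounterMachine k α Q) : Config k Q where
  state := M.start
  pos := 1
  counter := fun _ => 0

/-- `M.Step w c c'`: on input `w`, the machine can go from `c` to `c'` in one step. -/
def Step (M : CounterMachine k α Q) (w : List α) (c c' : Config k Q) : Prop :=
  ∃ (d : SignType) (e : Fin k → SignType),
    (c'.state, d, e) ∈ M.next c.state (tape w c.pos) (fun j => decide (c.counter j = 0)) ∧
    (c'.pos : ℤ) = (c.pos : ℤ) + (d : ℤ) ∧
    c'.pos ≤ w.length + 1 ∧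
    ∀ j, c'.counter j = c.counter j + (e j : ℤ)

/-- `M.Reaches w t c`: on input `w`, some computation of exactly `t` steps leads from the initial
configuration to `c`. -/
inductive Reaches (M : CounterMachine k α Q) (w : List α) : ℕ → Config k Q → Prop
  | zero : Reaches M w 0 M.initial
  | succ {t : ℕ} {c c' : Config k Q} : Reaches M w t c → M.Step w c c' → Reaches M w (t + 1) c'

/-- `M` has a computation on `w` that is in an accepting state after exactly `t` steps. -/
def AcceptsIn (M : CounterMachine k α Q) (w : List α) (t : ℕ) : Prop :=
  ∃ c, M.Reaches w t c ∧ c.state ∈ M.accept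

/-- The language accepted by `M`. -/
def language (M : CounterMachine k α Q) : Language α :=
  {w | ∃ t, M.AcceptsIn w t}

end CounterMachine

/-- The alphabet `{0, 1, $}`. -/
inductive Letter where
  | zero
  | one
  | dollar

/-- A binary digit as a letter. -/
def Letter.ofBit : Bool → Letter
  | false => .zero
  | true => .one

/-- The language of the words `x 0^e $ 0^e x^T` with `x ∈ {0,1}*` and `e = 2^(|x|/m) - |x|`, where
`x` ranges over the words for which `e` is a natural number: the power `2^(|x|/m)` is an integer
if and only if `m` divides `|x|`. -/
def desertPalindromes (m : ℕ) : Language Letter :=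
  {w | ∃ x : List Bool, m ∣ x.length ∧ x.length ≤ 2 ^ (x.length / m) ∧
    w = x.map Letter.ofBit ++ List.replicate (2 ^ (x.length / m) - x.length) Letter.zero ++
      [Letter.dollar] ++
      List.replicate (2 ^ (x.length / m) - x.length) Letter.zero ++ (x.map Letter.ofBit).reverse}

/-! Crossing sequences. Let `D = 2 ^ q`, `l = m * q`, `e = D - l`, and suppose that every `x 0^e $
0^e x^T` with `|x| = l` is accepted in fewer than `m * (2 * D + 1) / 13` steps. A full crossing of
the desert between the two binary blocks costs `2 * e + 2` steps, nearly the whole word length, so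
there are at most `m / 12` of them. The configuration at the end of a crossing (state, head, four
counters of size `O(D)`) takes `O(D ^ 5)`, hence for large `D` fewer than `D ^ 6`, values. So there
are at most `2 * D ^ (m / 2)` histories of crossings (`counting_bound_lt`), fewer than the `2 ^ l =
D ^ m` words `x`. Two words `x ≠ y` share a history, and cut and paste (`exists_reaches_of_agree`)
makes the machine accept `x 0^e $ 0^e y^T`, which is not a palindrome. -/

/-! ### Computations divided at the crossings of a block of the tape -/

namespace CounterMachine

variable {k : ℕ} {α Q : Type*}

/-- The side `false` consists of the positions `p ≤ l`, the side `true` of the positions `p ≥ r`.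
`OppositeSide l r s p` says that `p` is on the side opposite to `s`. -/
def OppositeSide (l r : ℕ) : Bool → ℕ → Prop
  | false, p => r ≤ p
  | true, p => p ≤ l

/-- The distance of the position `p` from the side `s`. -/
def sideDist (l r : ℕ) : Bool → ℕ → ℕ
  | false, p => p - l
  | true, p => r - p

/-- `M.CrossingRun l r w s h c`: on input `w`, some computation leads from the initial
configuration to `c` in such a way that `s` is the side visited last and `h` lists, starting with
the most recent one, the configurations in which a new side was reached. -/
inductive CrossingRun (M : CounterMachine k α Q) (l r : ℕ) (w : List α) :
    Bool → List (Config k Q) → Config k Q → Prop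
  | zero : CrossingRun M l r w false [] M.initial
  | stay {s : Bool} {h : List (Config k Q)} {c c' : Config k Q} :
      CrossingRun M l r w s h c → M.Step w c c' → ¬ OppositeSide l r s c'.pos →
      CrossingRun M l r w s h c'
  | cross {s s' : Bool} {h : List (Config k Q)} {c c' : Config k Q} :
      CrossingRun M l r w s h c → M.Step w c c' → OppositeSide l r s c'.pos → s' = !s →
      CrossingRun M l r w s' (c' :: h) c'

variable {M : CounterMachine k α Q} {l r : ℕ} {w : List α}

theorem CrossingRun.not_opposite (hl : 1 ≤ l) (hlr : l < r) {s : Bool} {h : List (Config k Q)}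
    {c : Config k Q} (hc : M.CrossingRun l r w s h c) : ¬ OppositeSide l r s c.pos := by
  induction hc with
  | zero => simp only [OppositeSide, initial]; omega
  | stay _ _ h _ => exact h
  | @cross s _ _ _ _ _ _ h hs _ =>
    subst hs
    cases s <;> simp only [OppositeSide, Bool.not_true, Bool.not_false] at h ⊢ <;> omega

theorem CrossingRun.exists_cross {s : Bool} {h h' : List (Config k Q)} {a c : Config k Q}
    (hc : M.CrossingRun l r w s h c) (hh : h = a :: h') :
    ∃ c', M.CrossingRun l r w (!s) h' c' ∧ M.Step w c' a := by
  induction hc with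
  | zero => cases hh
  | stay _ _ _ ih => exact ih hh
  | cross hr hstep _ hs =>
    cases hh
    subst hs
    exact ⟨_, by simpa using hr, hstep⟩

theorem Step.congr_tape {w' : List α} {c c' : Config k Q} (h : M.Step w c c')
    (hlen : w.length = w'.length) (htape : tape w c.pos = tape w' c.pos) : M.Step w' c c' := by
  obtain ⟨d, e, h1, h2, h3, h4⟩ := h
  exact ⟨d, e, htape ▸ h1, h2, hlen ▸ h3, h4⟩

/-- Cut and paste: computations on two words with the same crossing configurations give a
computation on a word that agrees with one of them away from the right side and with the other
away from the left side. -/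
theorem CrossingRun.exists_reaches_of_agree (hl : 1 ≤ l) (hlr : l < r) (W : Bool → List α)
    {v : List α} (hlen : ∀ s, (W s).length = v.length)
    (htape : ∀ s p, ¬ OppositeSide l r s p → tape (W s) p = tape v p) :
    ∀ (h : List (Config k Q)) (s : Bool), (∀ b, ∃ c, M.CrossingRun l r (W b) s h c) →
      ∀ c, M.CrossingRun l r (W s) s h c → ∃ t, M.Reaches v t c := by
  intro h
  induction h with
  | nil =>
    intro s hall c hc
    clear hall
    generalize hu : W s = u at hc
    generalize hh : ([] : List (Config k Q)) = h at hc
    induction hc with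
    | zero => exact ⟨0, .zero⟩
    | stay hr hstep _ ih =>
      obtain ⟨t, ht⟩ := ih hu hh
      subst hu
      exact ⟨t + 1, ht.succ (hstep.congr_tape (hlen _) (htape _ _ (hr.not_opposite hl hlr)))⟩
    | cross => cases hh
  | cons a h' ihh =>
    intro s hall c hc
    -- The configuration `a` was entered from the side `!s`, so the computation on `v` up to `a` has
    -- to be copied from `W (!s)`; this is why the history is assumed on both words.
    have hback : ∀ b, ∃ c', M.CrossingRun l r (W b) (!s) h' c' ∧ M.Step (W b) c' a := fun b =>
      (hall b).elim fun _ hb => hb.exists_cross rfl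
    generalize hu : W s = u at hc
    generalize hh : a :: h' = h at hc
    induction hc with
    | zero => cases hh
    | stay hr hstep _ ih =>
      obtain ⟨t, ht⟩ := ih hall hback hu hh
      subst hu
      exact ⟨t + 1, ht.succ (hstep.congr_tape (hlen _) (htape _ _ (hr.not_opposite hl hlr)))⟩
    | cross =>
      cases hh
      obtain ⟨c₀, hc₀, hstep⟩ := hback (!_)
      obtain ⟨t, ht⟩ := ihh _ (fun b => (hback b).imp fun _ h => h.1) c₀ hc₀
      exact ⟨t + 1, ht.succ
        (hstep.congr_tape (hlen _) (htape _ _ (hc₀.not_opposite hl hlr)))⟩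

theorem abs_signType_le_one (d : SignType) : |(d : ℤ)| ≤ 1 := by
  cases d <;> simp

/-- A computation of `t` steps crosses the block between `l` and `r` at most `t / (r - l)` times. -/
theorem Reaches.exists_crossingRun (hl : 1 ≤ l) (hlr : l < r) {t : ℕ} {c : Config k Q}
    (hc : M.Reaches w t c) :
    (∀ j, |c.counter j| ≤ t) ∧ ∃ s h, M.CrossingRun l r w s h c ∧
      h.length * (r - l) + sideDist l r s c.pos ≤ t ∧
      ∀ a ∈ h, a.pos ≤ w.length + 1 ∧ ∀ j, |a.counter j| ≤ t := by
  induction hc with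
  | zero =>
    refine ⟨by simp [initial], false, [], .zero, ?_, by simp⟩
    simp only [sideDist, initial, List.length_nil]
    omega
  | @succ t c c' _ hstep ih =>
    obtain ⟨hcount, s, h, hrun, htime, hmem⟩ := ih
    obtain ⟨d, e, -, hpos, hbound, hcounter⟩ := id hstep
    have hcount' : ∀ j, |c'.counter j| ≤ ((t + 1 : ℕ) : ℤ) := fun j => by
      rw [hcounter j]
      have h1 := abs_add_le (c.counter j) (e j : ℤ)
      have h2 := abs_signType_le_one (e j)
      have h3 := hcount j
      push_cast
      linarith
    have hmem' : ∀ a ∈ h, a.pos ≤ w.length + 1 ∧ ∀ j, |a.counter j| ≤ ((t + 1 : ℕ) : ℤ) :=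
      fun a ha => ⟨(hmem a ha).1, fun j => ((hmem a ha).2 j).trans (by push_cast; linarith)⟩
    have hd := abs_le.1 (abs_signType_le_one d)
    refine ⟨hcount', ?_⟩
    by_cases hopp : OppositeSide l r s c'.pos
    -- The distance from the old side has grown to at least `r - l`, which pays for the new entry;
    -- the truncated distance from the new side is `0`.
    · refine ⟨!s, c' :: h, hrun.cross hstep hopp rfl, ?_, ?_⟩
      · rw [List.length_cons, Nat.succ_mul]
        cases s <;> simp only [OppositeSide, sideDist, Bool.not_true, Bool.not_false] at * <;> omega
      · intro a ha
        rcases List.mem_cons.1 ha with rfl | ha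
        · exact ⟨hbound, hcount'⟩
        · exact hmem' a ha
    · refine ⟨s, h, hrun.stay hstep hopp, ?_, hmem'⟩
      cases s <;> simp only [sideDist] at * <;> omega

/-- The configurations with head position at most `p` and counters of absolute value at most `b`. -/
def boundedConfigs (k : ℕ) (Q : Type*) (p b : ℕ) : Set (Config k Q) :=
  {c | c.pos ≤ p ∧ ∀ j, |c.counter j| ≤ (b : ℤ)}

theorem finite_boundedConfigs_and_card_le (k : ℕ) (Q : Type*) [Finite Q] (p b : ℕ) :
    Finite (boundedConfigs k Q p b) ∧
      Nat.card (boundedConfigs k Q p b) ≤ Nat.card Q * ((p + 1) * (2 * b + 1) ^ k) := by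
  let f : boundedConfigs k Q p b → Q × Fin (p + 1) × (Fin k → Finset.Icc (-(b : ℤ)) b) :=
    fun c => (c.1.state, ⟨c.1.pos, Nat.lt_succ_of_le c.2.1⟩,
      fun j => ⟨c.1.counter j, Finset.mem_Icc.2 (abs_le.1 (c.2.2 j))⟩)
  have hf : Function.Injective f := by
    rintro ⟨⟨q, i, u⟩, hc⟩ ⟨⟨q', i', u'⟩, hc'⟩ h
    simp only [f, Prod.mk.injEq, Fin.mk.injEq, funext_iff, Subtype.mk.injEq] at h
    obtain ⟨rfl, rfl, h⟩ := h
    obtain rfl : u = u' := funext h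
    rfl
  refine ⟨Finite.of_injective f hf, (Nat.card_le_card_of_injective f hf).trans_eq ?_⟩
  rw [Nat.card_prod, Nat.card_prod, Nat.card_fun, Nat.card_fin, Nat.card_fin,
    Nat.card_eq_fintype_card (α := Finset.Icc (-(b : ℤ)) b), Fintype.card_coe, Int.card_Icc]
  congr 3
  omega

end CounterMachine

/-! ### Counting short lists -/

/-- A list of length at most `K` is determined by its entries at the indices below `K`, where `none`
marks indices past its end. -/
theorem card_le_of_injective_short_lists {X S : Type*} [Finite S] (K : ℕ)
    (F : X → Bool × List S) (hF : Function.Injective F) (hK : ∀ x, (F x).2.length ≤ K) :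
    Nat.card X ≤ 2 * (Nat.card S + 1) ^ K := by
  have : Fintype S := Fintype.ofFinite S
  let G : X → Bool × (Fin K → Option S) := fun x => ((F x).1, fun i => (F x).2[(i : ℕ)]?)
  have hG : Function.Injective G := by
    intro x y hxy
    simp only [G, Prod.mk.injEq] at hxy
    refine hF (Prod.ext hxy.1 (List.ext_getElem? fun i => ?_))
    rcases lt_or_ge i K with hi | hi
    · exact congrFun hxy.2 ⟨i, hi⟩
    · rw [List.getElem?_eq_none ((hK x).trans hi), List.getElem?_eq_none ((hK y).trans hi)]
  refine (Nat.card_le_card_of_injective G hG).trans_eq ?_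
  simp [Nat.card_eq_fintype_card]

/-! ### The words of the language -/

/-- The word `x 0^e $ 0^e y^T`. -/
def desertWord (e : ℕ) (x y : List Bool) : List Letter :=
  x.map Letter.ofBit ++ (List.replicate e Letter.zero ++ [Letter.dollar] ++
    List.replicate e Letter.zero) ++ (y.map Letter.ofBit).reverse

theorem Letter.ofBit_injective : Function.Injective Letter.ofBit := by
  rintro (_ | _) (_ | _) h <;> first | rfl | cases h

theorem length_desertWord (e : ℕ) (x y : List Bool) :
    (desertWord e x y).length = x.length + (2 * e + 1) + y.length := by
  simp only [desertWord, List.length_append, List.length_map, List.length_replicate,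
    List.length_reverse, List.length_singleton]
  omega

theorem mem_desertPalindromes_iff {m : ℕ} {w : List Letter} : w ∈ desertPalindromes m ↔
    ∃ x : List Bool, m ∣ x.length ∧ x.length ≤ 2 ^ (x.length / m) ∧
      w = desertWord (2 ^ (x.length / m) - x.length) x x := by
  simp only [desertWord, ← List.append_assoc]
  rfl

theorem reverse_desertWord (e : ℕ) (x y : List Bool) :
    (desertWord e x y).reverse = desertWord e y x := by
  simp [desertWord]

/-- All words of the language are palindromes. Comparing prefixes of the word and its reversal
suffices, so `z` and its exponent need not be matched with `x` and `e`. -/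
theorem eq_of_desertWord_mem {m e : ℕ} {x y : List Bool} (hxy : x.length = y.length)
    (h : desertWord e x y ∈ desertPalindromes m) : x = y := by
  obtain ⟨z, -, -, hz⟩ := mem_desertPalindromes_iff.1 h
  have hrev : desertWord e x y = desertWord e y x := by
    rw [← reverse_desertWord e x y, hz, reverse_desertWord]
  simp only [desertWord, List.append_assoc] at hrev
  exact List.map_injective_iff.2 Letter.ofBit_injective
    (List.append_inj_left hrev (by simpa using hxy))

theorem tape_desertWord_left {e p : ℕ} {x y : List Bool} (hp : p < x.length + (2 * e + 1) + 1)
    (z : List Bool) :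
    CounterMachine.tape (desertWord e x z) p = CounterMachine.tape (desertWord e x y) p := by
  cases p with
  | zero => rfl
  | succ p =>
    have h : ∀ z : List Bool, (desertWord e x z)[p]? =
        (x.map Letter.ofBit ++ (List.replicate e Letter.zero ++ [Letter.dollar] ++
          List.replicate e Letter.zero))[p]? := fun z =>
      List.getElem?_append_left (by
        simp only [List.length_append, List.length_map, List.length_replicate,
          List.length_singleton]
        omega)
    simp only [CounterMachine.tape, h]

theorem tape_desertWord_right {e p : ℕ} {x y z : List Bool} (hp : x.length < p)
    (hz : z.length = x.length) :
    CounterMachine.tape (desertWord e z y) p = CounterMachine.tape (desertWord e x y) p := by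
  cases p with
  | zero => rfl
  | succ p =>
    have h : ∀ z : List Bool, z.length = x.length → (desertWord e z y)[p]? =
        ((List.replicate e Letter.zero ++ [Letter.dollar] ++
          List.replicate e Letter.zero) ++ (y.map Letter.ofBit).reverse)[p - x.length]? := by
      intro z hz
      rw [desertWord, List.append_assoc, List.getElem?_append_right (by simp; omega),
        List.length_map, hz]
    simp only [CounterMachine.tape, h z hz, h x rfl]

/-! ### The lower bound -/

open CounterMachine in
/-- If a machine accepts all words `x 0^e $ 0^e x^T` with `|x| = l` in time at most `T` and no
other word `x 0^e $ 0^e y^T` with `|x| = |y| = l`, then the number of the words `x` is at most the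
number of possible lists of crossing configurations. -/
theorem two_pow_le_of_acceptsIn {k : ℕ} {Q : Type*} [Finite Q] (M : CounterMachine k Letter Q)
    {e l T K : ℕ} (hl : 1 ≤ l) (hK : ∀ i, i * (2 * e + 2) ≤ T → i ≤ K)
    (hacc : ∀ x : List Bool, x.length = l → ∃ t ≤ T, M.AcceptsIn (desertWord e x x) t)
    (hrej : ∀ x y : List Bool, x.length = l → y.length = l →
      desertWord e x y ∈ M.language → x = y) :
    2 ^ l ≤ 2 * (Nat.card Q * ((2 * l + 2 * e + 3) * (2 * T + 1) ^ k) + 1) ^ K := by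
  set r := l + (2 * e + 1) + 1 with hr
  have hlr : l < r := by omega
  set S := boundedConfigs k Q (2 * l + 2 * e + 2) T
  obtain ⟨hfin, hcard⟩ := finite_boundedConfigs_and_card_le k Q (2 * l + 2 * e + 2) T
  have key : ∀ x : List.Vector Bool l, ∃ sh : Bool × List S, sh.2.length ≤ K ∧
      ∃ c, M.CrossingRun l r (desertWord e x.1 x.1) sh.1 (sh.2.map Subtype.val) c ∧
        c.state ∈ M.accept := by
    intro x
    obtain ⟨t, htT, c, hreach, hc⟩ := hacc x.1 x.2
    obtain ⟨-, s, h, hrun, htime, hmem⟩ := hreach.exists_crossingRun hl hlr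
    rw [length_desertWord, x.2] at hmem
    have hS : ∀ a ∈ h, a ∈ S := fun a ha =>
      ⟨(hmem a ha).1.trans (by omega), fun j => ((hmem a ha).2 j).trans (by exact_mod_cast htT)⟩
    lift h to List S using hS
    rw [List.length_map] at htime
    refine ⟨(s, h), hK _ ?_, c, hrun, hc⟩
    have : r - l = 2 * e + 2 := by omega
    rw [this] at htime
    exact (Nat.le_add_right _ _).trans (htime.trans htT)
  choose F hFK hF using key
  have hinj : Function.Injective F := by
    intro x y hxy
    obtain ⟨c, hc, hcacc⟩ := hF x
    obtain ⟨d, hd, hdacc⟩ := hF y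
    rw [← hxy] at hd
    refine Subtype.ext (hrej x.1 y.1 x.2 y.2 ?_)
    let W : Bool → List Letter := fun b => cond b (desertWord e y.1 y.1) (desertWord e x.1 x.1)
    have hW : ∀ b, ∃ c, M.CrossingRun l r (W b) (F x).1 ((F x).2.map Subtype.val) c ∧
        c.state ∈ M.accept := by
      rintro (_ | _)
      exacts [⟨c, hc, hcacc⟩, ⟨d, hd, hdacc⟩]
    -- The pasted computation ends as the computation on the word belonging to the last side does,
    -- so it accepts.
    obtain ⟨a, ha, haacc⟩ := hW (F x).1
    obtain ⟨t, ht⟩ := CrossingRun.exists_reaches_of_agree hl hlr W (v := desertWord e x.1 y.1)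
      (by rintro (_ | _) <;> simp [W, length_desertWord, x.2, y.2])
      (by
        rintro (_ | _) p hp
        · exact tape_desertWord_left (by simp only [OppositeSide, x.2] at hp ⊢; omega) _
        · exact tape_desertWord_right (by simp only [OppositeSide, x.2] at hp ⊢; omega)
            (by rw [x.2, y.2]))
      _ _ (fun b => (hW b).imp fun _ h => h.1) a ha
    exact ⟨t, a, ht, haacc⟩
  calc 2 ^ l = Nat.card (List.Vector Bool l) := by
        rw [Nat.card_eq_fintype_card, card_vector, Fintype.card_bool]
    _ ≤ 2 * (Nat.card S + 1) ^ K := card_le_of_injective_short_lists K F hinj hFK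
    _ ≤ _ := by gcongr

theorem sq_le_two_pow {q : ℕ} (hq : 4 ≤ q) : q * q ≤ 2 ^ q := by
  induction q, hq using Nat.le_induction with
  | base => norm_num
  | succ q hq ih => rw [pow_succ]; nlinarith

/-- The numerical contradiction: `D ^ m` words, but few lists of crossing configurations. -/
theorem counting_bound_lt {m D K C : ℕ} (hm : 1 ≤ m) (hD : 5 ≤ D)
    (hCD : 12006 * (C * m ^ 4 + 1) ≤ D) (hK : 12 * K ≤ m) :
    2 * (C * ((2 * D + 3) * (2 * (m * (2 * D + 1)) + 1) ^ 4) + 1) ^ K < D ^ m := by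
  -- Degree 5 in `D`: one factor for the head, four for the counters. The constant is `5 * 7 ^ 4 =
  -- 12005`, and a sixth factor `D` absorbs it together with `C * m ^ 4`.
  have h1 : C * ((2 * D + 3) * (2 * (m * (2 * D + 1)) + 1) ^ 4) + 1 ≤ D ^ 6 := by
    have hb : 2 * (m * (2 * D + 1)) + 1 ≤ 7 * (m * D) := by nlinarith
    have h2 : 1 ≤ D ^ 5 := Nat.one_le_pow _ _ (by omega)
    calc C * ((2 * D + 3) * (2 * (m * (2 * D + 1)) + 1) ^ 4) + 1
        ≤ C * ((5 * D) * (7 * (m * D)) ^ 4) + D ^ 5 := by gcongr; omega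
      _ = (12005 * (C * m ^ 4) + 1) * D ^ 5 := by ring
      _ ≤ D * D ^ 5 := by gcongr; omega
      _ = D ^ 6 := by ring
  have h2 : (D ^ (6 * K)) ^ 2 ≤ D ^ m := by
    rw [← pow_mul]
    exact Nat.pow_le_pow_right (by omega) (by omega)
  have h3 : D ≤ D ^ m := Nat.le_self_pow (by omega) D
  calc 2 * (C * ((2 * D + 3) * (2 * (m * (2 * D + 1)) + 1) ^ 4) + 1) ^ K
      ≤ 2 * (D ^ 6) ^ K := by gcongr
    _ = 2 * D ^ (6 * K) := by rw [pow_mul]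
    _ < D ^ m := by
      -- With `a = D ^ (6 * K)`, `a ^ 2 ≤ D ^ m ≤ 2 * a` would give `a ≤ 2` and `D ≤ D ^ m ≤ 4`.
      by_contra! hcon
      nlinarith

theorem mem_desertPalindromes_of_length {m q : ℕ} (hm : 1 ≤ m) (hq : m * q ≤ 2 ^ q)
    {x : List Bool} (hx : x.length = m * q) :
    desertWord (2 ^ q - m * q) x x ∈ desertPalindromes m := by
  have hdiv : x.length / m = q := by rw [hx, Nat.mul_div_cancel_left _ (by omega)]
  exact mem_desertPalindromes_iff.2 ⟨x, ⟨q, hx⟩, by rwa [hdiv, hx], by rw [hdiv, hx]⟩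

/-- For large `q`, some word of length `2 * 2 ^ q + 1` is not accepted in time less than `m / 13`
times its length. -/
theorem exists_slow_word (m : ℕ) (hm : 1 ≤ m) {Q : Type*} [Finite Q]
    (M : CounterMachine 4 Letter Q) (hM : M.language = desertPalindromes m) {q : ℕ} (hq : 4 ≤ q)
    (hmq : 13 * m ≤ q) (hCq : 12006 * (Nat.card Q * m ^ 4 + 1) ≤ q) :
    ∃ w ∈ desertPalindromes m, w.length = 2 * 2 ^ q + 1 ∧
      ∀ t : ℕ, M.AcceptsIn w t → m * (2 * 2 ^ q + 1) ≤ 13 * t := by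
  by_contra! hcon
  have hqD : q < 2 ^ q := Nat.lt_two_pow_self
  have hl : 13 * (m * q) ≤ 2 ^ q := by
    have := Nat.mul_le_mul_right q hmq
    have := sq_le_two_pow hq
    nlinarith
  set D := 2 ^ q with hD
  obtain ⟨e, he⟩ : ∃ e, D - m * q = e := ⟨_, rfl⟩
  have hlt : ∀ x : List Bool, x.length = m * q →
      ∃ t, M.AcceptsIn (desertWord e x x) t ∧ 13 * t < m * (2 * D + 1) := fun x hx =>
    hcon _ (he ▸ mem_desertPalindromes_of_length hm (by omega) hx)
      (by rw [length_desertWord, hx]; omega)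
  -- The largest `T` with `13 * T < m * (2 * D + 1)`.
  obtain ⟨T, hT⟩ : ∃ T, T = (m * (2 * D + 1) - 1) / 13 := ⟨_, rfl⟩
  have hpos : 0 < m * (2 * D + 1) := by positivity
  have hmain := two_pow_le_of_acceptsIn M (e := e) (l := m * q) (T := T) (K := m / 12)
    (Nat.mul_pos hm (by omega)) (fun i hi => by
      have h1 : 13 * (i * (2 * e + 2)) < m * (2 * D + 1) := by omega
      -- By `hl`, a crossing takes at least `12 / 13` of the word length; this loss turns `m / 13`
      -- into `m / 12`.
      have h2 : 12 * (2 * D + 1) ≤ 13 * (2 * e + 2) := by omega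
      have h3 := Nat.mul_le_mul_left i h2
      have h4 : (i * 12) * (2 * D + 1) < m * (2 * D + 1) := by linarith
      have h5 := Nat.lt_of_mul_lt_mul_right h4
      omega)
    (fun x hx => (hlt x hx).imp fun t ht => ⟨by omega, ht.1⟩)
    (fun x y hx hy h => eq_of_desertWord_mem (hx.trans hy.symm) (hM ▸ h))
  have hnum := counting_bound_lt (C := Nat.card Q) (K := m / 12) (D := D) hm (by omega)
    (by omega) (by omega)
  refine absurd hmain (not_le.2 (lt_of_le_of_lt ?_ (hnum.trans_eq ?_)))
  · have h1 : 2 * (m * q) + 2 * e + 3 = 2 * D + 3 := by omega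
    have h2 : T ≤ m * (2 * D + 1) := by omega
    rw [h1]
    gcongr
  · rw [hD, ← pow_mul, mul_comm]

theorem mainTheorem6 (m : ℕ) (hm : 1 ≤ m) {Q : Type*} [Finite Q]
    (M : CounterMachine 4 Letter Q) (hM : M.language = desertPalindromes m) :
    (∃ N : ℕ, ∀ n : ℕ, N ≤ n → (∃ w ∈ desertPalindromes m, w.length = n) →
      ∃ w ∈ desertPalindromes m, w.length = n ∧
        ∀ t : ℕ, M.AcceptsIn w t → (m : ℝ) / 13 * (n : ℝ) ≤ (t : ℝ)) ∧
    (∀ c : ℝ, c < (m : ℝ) / 13 →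
      ¬ ∃ N : ℕ, ∀ w ∈ desertPalindromes m, N ≤ w.length →
        ∃ t : ℕ, M.AcceptsIn w t ∧ (t : ℝ) ≤ c * (w.length : ℝ)) := by
  obtain ⟨q₀, hq₀⟩ : ∃ q₀, q₀ = 4 + 13 * m + 12006 * (Nat.card Q * m ^ 4 + 1) := ⟨_, rfl⟩
  have hslow : ∀ q, q₀ ≤ q → ∃ w ∈ desertPalindromes m, w.length = 2 * 2 ^ q + 1 ∧
      ∀ t : ℕ, M.AcceptsIn w t → (m : ℝ) / 13 * ((2 * 2 ^ q + 1 : ℕ) : ℝ) ≤ (t : ℝ) := by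
    intro q hq
    obtain ⟨w, hw, hlen, ht⟩ :=
      exists_slow_word m hm M hM (q := q) (by omega) (by omega) (by omega)
    refine ⟨w, hw, hlen, fun t hacc => ?_⟩
    have h : (m : ℝ) * ((2 * 2 ^ q + 1 : ℕ) : ℝ) ≤ 13 * (t : ℝ) := by exact_mod_cast ht t hacc
    linarith
  refine ⟨⟨2 * 2 ^ q₀ + 1, ?_⟩, ?_⟩
  · rintro n hn ⟨w, hw, rfl⟩
    obtain ⟨x, -, hx, rfl⟩ := mem_desertPalindromes_iff.1 hw
    have hlen : (desertWord (2 ^ (x.length / m) - x.length) x x).length =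
        2 * 2 ^ (x.length / m) + 1 := by
      rw [length_desertWord]
      omega
    rw [hlen] at hn ⊢
    -- Every length occurring in the language is `2 * 2 ^ q + 1` with `q = |x| / m`, so large `n`
    -- forces large `q`.
    exact hslow _ ((Nat.pow_le_pow_iff_right (a := 2) (by norm_num)).1 (by omega))
  · rintro c hc ⟨N, hN⟩
    obtain ⟨w, hw, hlen, ht⟩ := hslow (q₀ + N) (by omega)
    have hNw : N ≤ w.length := by
      have : q₀ + N < 2 ^ (q₀ + N) := Nat.lt_two_pow_self
      omega
    obtain ⟨t, hacc, hle⟩ := hN w hw hNw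
    have h1 := ht t hacc
    rw [← hlen] at h1
    have h2 : (0 : ℝ) < w.length := by
      rw [hlen]
      positivity
    nlinarith
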